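/- Let $Vir$ denote the Virasoro algebra, i.e. the complex Lie algebra with basis $\{L_m, c \mid m\in\mathbb{Z}\}$, where $c$ is central and $$[L_m,L_n]=(m-n)L_{m+n}+\frac{m^3-m}{12}\,\delta_{m+n,0}\,c .$$ Let $W(2,2)$ denote the complex Lie algebra with basis $\{L_m,H_m,c\mid m\in\mathbb{Z}\}$, where $c$ is central and $$[L_m,L_n]=(m-n)L_{m+n}+\frac{m^3-m}{12}\,\delta_{m+n,0}\,c,\qquad [L_m,H_n]=(m-n)H_{m+n}+\frac{m^3-m}{12}\,\delta_{m+n,0}\,c,\qquad [H_m,H_n]=0 .$$ A commutative post-Lie algebra structure on a complex Lie algebra $L$ is a $\mathbb{C}$-bilinear product $x\cdot y$ on $L$ such that, for all $x,y,z\in L$, $$x\cdot y=y\cdot x,\qquad [x,y]\cdot z=x\cdot(y\cdot z)-y\cdot(x\cdot z),\qquad x\cdot[y,z]=[x\cdot y,z]+[y,x\cdot z].$$ **Theorem.** Let $L$ be the Virasoro algebra $Vir$ or the W-algebra $W(2,2)$. Then every commutative post-Lie algebra structure on $L$ is trivial, that is, $x\cdot y=0$ for all $x,y\in L$. -/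

import Mathlib

noncomputable section

/-- The bilinear product on the free complex vector space on `ι` which is given on basis
vectors by `β i j`. -/
def bilinearExtension {ι : Type} (β : ι → ι → (ι →₀ ℂ)) :
    (ι →₀ ℂ) →ₗ[ℂ] (ι →₀ ℂ) →ₗ[ℂ] (ι →₀ ℂ) :=
  Finsupp.linearCombination ℂ fun i => Finsupp.linearCombination ℂ (β i)

theorem bilinearExtension_single {ι : Type} (β : ι → ι → (ι →₀ ℂ)) (i j : ι) (a b : ℂ) :
    bilinearExtension β (Finsupp.single i a) (Finsupp.single j b) = (a * b) • β i j := by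
  simp [bilinearExtension, Finsupp.linearCombination_single, smul_smul]

theorem bilinearExtension_skew {ι : Type} (β : ι → ι → (ι →₀ ℂ))
    (h : ∀ i j, β i j = -β j i) (x y : ι →₀ ℂ) :
    bilinearExtension β x y = -bilinearExtension β y x := by
  induction x using Finsupp.induction_linear with
  | zero => simp
  | add x₁ x₂ h₁ h₂ => rw [map_add, LinearMap.add_apply, h₁, h₂, map_add, neg_add]
  | single i a =>
    induction y using Finsupp.induction_linear with
    | zero => simp
    | add y₁ y₂ h₁ h₂ => rw [map_add, h₁, h₂, map_add, LinearMap.add_apply, neg_add]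
    | single j b =>
      rw [bilinearExtension_single, bilinearExtension_single, h i j, smul_neg, mul_comm]

theorem bilinearExtension_self {ι : Type} (β : ι → ι → (ι →₀ ℂ))
    (h : ∀ i j, β i j = -β j i) (x : ι →₀ ℂ) : bilinearExtension β x x = 0 :=
  self_eq_neg.mp (bilinearExtension_skew β h x x)

theorem bilinearExtension_leibniz {ι : Type} (β : ι → ι → (ι →₀ ℂ))
    (h : ∀ i j k, bilinearExtension β (Finsupp.single i 1) (β j k) =
      bilinearExtension β (β i j) (Finsupp.single k 1) +
        bilinearExtension β (Finsupp.single j 1) (β i k))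
    (x y z : ι →₀ ℂ) :
    bilinearExtension β x (bilinearExtension β y z) =
      bilinearExtension β (bilinearExtension β x y) z +
        bilinearExtension β y (bilinearExtension β x z) := by
  have single_eq : ∀ (i : ι) (a : ℂ), Finsupp.single i a = a • Finsupp.single i (1 : ℂ) := by
    intro i a; simp
  have one : ∀ i j, bilinearExtension β (Finsupp.single i 1) (Finsupp.single j 1) = β i j := by
    intro i j; simp [bilinearExtension_single]
  induction x using Finsupp.induction_linear with
  | zero => simp
  | add x₁ x₂ h₁ h₂ => simp only [map_add, LinearMap.add_apply, h₁, h₂]; abel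
  | single i a =>
    induction y using Finsupp.induction_linear with
    | zero => simp
    | add y₁ y₂ h₁ h₂ => simp only [map_add, LinearMap.add_apply, h₁, h₂]; abel
    | single j b =>
      induction z using Finsupp.induction_linear with
      | zero => simp
      | add z₁ z₂ h₁ h₂ => simp only [map_add, h₁, h₂]; abel
      | single k c =>
        rw [single_eq i a, single_eq j b, single_eq k c]
        simp only [map_smul, LinearMap.smul_apply, one]
        rw [h i j k, smul_add, smul_add, smul_add, smul_comm b a (bilinearExtension β _ (β i k))]

/-- The value `δ_{m+n,0} (m³ - m)/12` of the Virasoro cocycle. -/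
def virCocycle (m n : ℤ) : ℂ := if m + n = 0 then ((m : ℂ) ^ 3 - m) / 12 else 0

theorem virCocycle_skew (m n : ℤ) : virCocycle m n = -virCocycle n m := by
  unfold virCocycle
  rw [add_comm n m]
  split_ifs with h
  · obtain rfl : n = -m := by omega
    push_cast; ring
  · simp

theorem virCocycle_jacobi (m n p : ℤ) :
    ((n : ℂ) - p) * virCocycle m (n + p) =
      ((m : ℂ) - n) * virCocycle (m + n) p + ((m : ℂ) - p) * virCocycle n (m + p) := by
  unfold virCocycle
  rw [show n + (m + p) = m + (n + p) by ring, show m + n + p = m + (n + p) by ring]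
  split_ifs with h
  · obtain rfl : p = -m - n := by omega
    push_cast; ring
  · simp

/-- Labels of the basis `{L_m, c | m ∈ ℤ}` of the Virasoro algebra. -/
inductive VirIndex : Type
  | L (m : ℤ)
  | c

/-- The brackets of the basis vectors of the Virasoro algebra:
`[L_m, L_n] = (m - n) L_{m+n} + δ_{m+n,0} (m³ - m)/12 c`, and `c` is central. -/
def virBracket : VirIndex → VirIndex → (VirIndex →₀ ℂ)
  | .L m, .L n => Finsupp.single (.L (m + n)) ((m : ℂ) - n) +
      Finsupp.single .c (virCocycle m n)
  | _, _ => 0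

/-- The Virasoro algebra: the complex vector space with basis `{L_m, c | m ∈ ℤ}`. -/
def Virasoro : Type := VirIndex →₀ ℂ

namespace Virasoro

instance : AddCommGroup Virasoro := inferInstanceAs (AddCommGroup (VirIndex →₀ ℂ))

instance : Module ℂ Virasoro := inferInstanceAs (Module ℂ (VirIndex →₀ ℂ))

/-- The defining basis of the Virasoro algebra. -/
def basis : Module.Basis VirIndex ℂ Virasoro :=
  Module.Basis.ofRepr (LinearEquiv.refl ℂ (VirIndex →₀ ℂ))

/-- The basis vector `L_m`. -/
def L (m : ℤ) : Virasoro := basis (.L m)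

/-- The central basis vector `c`. -/
def c : Virasoro := basis .c

theorem bracket_skew (i j : VirIndex) : virBracket i j = -virBracket j i := by
  rcases i with m | _ <;> rcases j with n | _ <;>
    simp only [virBracket, neg_zero]
  all_goals
    rw [virCocycle_skew m n, add_comm n m, ← neg_sub (n : ℂ) (m : ℂ), Finsupp.single_neg,
      Finsupp.single_neg, neg_add]

theorem bracket_leibniz (i j k : VirIndex) :
    bilinearExtension virBracket (Finsupp.single i 1) (virBracket j k) =
      bilinearExtension virBracket (virBracket i j) (Finsupp.single k 1) +
        bilinearExtension virBracket (Finsupp.single j 1) (virBracket i k) := by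
  rcases i with m | _ <;> rcases j with n | _ <;> rcases k with p | _ <;>
    simp only [virBracket, map_add, map_zero, LinearMap.add_apply, LinearMap.zero_apply,
      bilinearExtension_single, smul_zero, add_zero, one_mul, mul_one]
  all_goals
    rw [add_left_comm n m p, add_assoc m n p]
    simp only [smul_add, Finsupp.smul_single, smul_eq_mul]
    rw [add_add_add_comm, ← Finsupp.single_add, ← Finsupp.single_add, virCocycle_jacobi m n p]
    congr 2
    push_cast; ring

instance : LieRing Virasoro where
  bracket x y := bilinearExtension virBracket x y
  add_lie x y z := LinearMap.map_add₂ (bilinearExtension virBracket) x y z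
  lie_add x y z := map_add (bilinearExtension virBracket x) y z
  lie_self x := bilinearExtension_self virBracket bracket_skew x
  leibniz_lie x y z := bilinearExtension_leibniz virBracket bracket_leibniz x y z

instance : LieAlgebra ℂ Virasoro where
  lie_smul t x y := map_smul (bilinearExtension virBracket x) t y

theorem lie_L_L (m n : ℤ) :
    ⁅L m, L n⁆ = ((m : ℂ) - n) • L (m + n) +
      (if m + n = 0 then ((m : ℂ) ^ 3 - m) / 12 else 0) • c := by
  have h : bilinearExtension virBracket (Finsupp.single (.L m) 1) (Finsupp.single (.L n) 1) =
      ((m : ℂ) - n) • Finsupp.single (.L (m + n)) (1 : ℂ) +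
        virCocycle m n • Finsupp.single .c (1 : ℂ) := by
    simp only [bilinearExtension_single, Finsupp.smul_single, virBracket, smul_eq_mul, mul_one,
      one_smul]
  exact h

theorem lie_c (x : Virasoro) : ⁅x, c⁆ = 0 := by
  change bilinearExtension virBracket x (Finsupp.single VirIndex.c 1) = 0
  induction x using Finsupp.induction_linear with
  | zero => simp
  | add x y hx hy => rw [map_add, LinearMap.add_apply, hx, hy, add_zero]
  | single i a => cases i <;> simp [bilinearExtension_single, virBracket]

end Virasoro

/-- Labels of the basis `{L_m, H_m, c | m ∈ ℤ}` of the W-algebra `W(2,2)`. -/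
inductive W22Index : Type
  | L (m : ℤ)
  | H (m : ℤ)
  | c

/-- The brackets of the basis vectors of `W(2,2)`:
`[L_m, L_n] = (m - n) L_{m+n} + δ_{m+n,0} (m³ - m)/12 c`,
`[L_m, H_n] = (m - n) H_{m+n} + δ_{m+n,0} (m³ - m)/12 c`,
`[H_m, H_n] = 0`, and `c` is central. By skew-symmetry,
`[H_m, L_n] = -[L_n, H_m] = (m - n) H_{m+n} + δ_{m+n,0} (m³ - m)/12 c`. -/
def w22Bracket : W22Index → W22Index → (W22Index →₀ ℂ)
  | .L m, .L n => Finsupp.single (.L (m + n)) ((m : ℂ) - n) +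
      Finsupp.single .c (virCocycle m n)
  | .L m, .H n => Finsupp.single (.H (m + n)) ((m : ℂ) - n) +
      Finsupp.single .c (virCocycle m n)
  | .H m, .L n => Finsupp.single (.H (m + n)) ((m : ℂ) - n) +
      Finsupp.single .c (virCocycle m n)
  | _, _ => 0

/-- The W-algebra `W(2,2)`: the complex vector space with basis `{L_m, H_m, c | m ∈ ℤ}`. -/
def W22 : Type := W22Index →₀ ℂ

namespace W22

instance : AddCommGroup W22 := inferInstanceAs (AddCommGroup (W22Index →₀ ℂ))

instance : Module ℂ W22 := inferInstanceAs (Module ℂ (W22Index →₀ ℂ))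

/-- The defining basis of `W(2,2)`. -/
def basis : Module.Basis W22Index ℂ W22 :=
  Module.Basis.ofRepr (LinearEquiv.refl ℂ (W22Index →₀ ℂ))

/-- The basis vector `L_m`. -/
def L (m : ℤ) : W22 := basis (.L m)

/-- The basis vector `H_m`. -/
def H (m : ℤ) : W22 := basis (.H m)

/-- The central basis vector `c`. -/
def c : W22 := basis .c

theorem bracket_skew (i j : W22Index) : w22Bracket i j = -w22Bracket j i := by
  rcases i with m | m | _ <;> rcases j with n | n | _ <;>
    simp only [w22Bracket, neg_zero]
  all_goals
    rw [virCocycle_skew m n, add_comm n m, ← neg_sub (n : ℂ) (m : ℂ), Finsupp.single_neg,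
      Finsupp.single_neg, neg_add]

theorem bracket_leibniz (i j k : W22Index) :
    bilinearExtension w22Bracket (Finsupp.single i 1) (w22Bracket j k) =
      bilinearExtension w22Bracket (w22Bracket i j) (Finsupp.single k 1) +
        bilinearExtension w22Bracket (Finsupp.single j 1) (w22Bracket i k) := by
  rcases i with m | m | _ <;> rcases j with n | n | _ <;> rcases k with p | p | _ <;>
    simp only [w22Bracket, map_add, map_zero, LinearMap.add_apply, LinearMap.zero_apply,
      bilinearExtension_single, smul_zero, add_zero, one_mul, mul_one]
  all_goals
    rw [add_left_comm n m p, add_assoc m n p]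
    simp only [smul_add, Finsupp.smul_single, smul_eq_mul]
    rw [add_add_add_comm, ← Finsupp.single_add, ← Finsupp.single_add, virCocycle_jacobi m n p]
    congr 2
    push_cast; ring

instance : LieRing W22 where
  bracket x y := bilinearExtension w22Bracket x y
  add_lie x y z := LinearMap.map_add₂ (bilinearExtension w22Bracket) x y z
  lie_add x y z := map_add (bilinearExtension w22Bracket x) y z
  lie_self x := bilinearExtension_self w22Bracket bracket_skew x
  leibniz_lie x y z := bilinearExtension_leibniz w22Bracket bracket_leibniz x y z

instance : LieAlgebra ℂ W22 where
  lie_smul t x y := map_smul (bilinearExtension w22Bracket x) t y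

theorem lie_L_L (m n : ℤ) :
    ⁅L m, L n⁆ = ((m : ℂ) - n) • L (m + n) +
      (if m + n = 0 then ((m : ℂ) ^ 3 - m) / 12 else 0) • c := by
  have h : bilinearExtension w22Bracket (Finsupp.single (.L m) 1) (Finsupp.single (.L n) 1) =
      ((m : ℂ) - n) • Finsupp.single (.L (m + n)) (1 : ℂ) +
        virCocycle m n • Finsupp.single .c (1 : ℂ) := by
    simp only [bilinearExtension_single, Finsupp.smul_single, w22Bracket, smul_eq_mul, mul_one,
      one_smul]
  exact h

theorem lie_L_H (m n : ℤ) :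
    ⁅L m, H n⁆ = ((m : ℂ) - n) • H (m + n) +
      (if m + n = 0 then ((m : ℂ) ^ 3 - m) / 12 else 0) • c := by
  have h : bilinearExtension w22Bracket (Finsupp.single (.L m) 1) (Finsupp.single (.H n) 1) =
      ((m : ℂ) - n) • Finsupp.single (.H (m + n)) (1 : ℂ) +
        virCocycle m n • Finsupp.single .c (1 : ℂ) := by
    simp only [bilinearExtension_single, Finsupp.smul_single, w22Bracket, smul_eq_mul, mul_one,
      one_smul]
  exact h

theorem lie_H_H (m n : ℤ) : ⁅H m, H n⁆ = 0 := by
  change bilinearExtension w22Bracket (Finsupp.single _ 1) (Finsupp.single _ 1) = 0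
  simp [bilinearExtension_single, w22Bracket]

theorem lie_c (x : W22) : ⁅x, c⁆ = 0 := by
  change bilinearExtension w22Bracket x (Finsupp.single W22Index.c 1) = 0
  induction x using Finsupp.induction_linear with
  | zero => simp
  | add x y hx hy => rw [map_add, LinearMap.add_apply, hx, hy, add_zero]
  | single i a => cases i <;> simp [bilinearExtension_single, w22Bracket]

end W22

/-- A bilinear product `x · y = p x y` on a complex Lie algebra `L` is a commutative post-Lie
algebra structure on `L`. -/
structure IsCommPostLie {L : Type*} [LieRing L] [LieAlgebra ℂ L]
    (p : L →ₗ[ℂ] L →ₗ[ℂ] L) : Prop where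
  comm : ∀ x y, p x y = p y x
  lie_left : ∀ x y z, p ⁅x, y⁆ z = p x (p y z) - p y (p x z)
  lie_right : ∀ x y z, p x ⁅y, z⁆ = ⁅p x y, z⁆ + ⁅y, p x z⁆

end

/-! The argument combines commutativity with the fact that every left multiplication is a
derivation. Modulo the centre, the `L m` obey the Witt relations. Each homogeneous component of a
Witt derivation is inner, so the structure constants of a product factor as `α m (k - n) * (k - 2 *
n)`, and symmetry in `m`, `n` forces `α = 0` (`witt_commutative_product_eq_zero`). Products of the
`L m` are therefore central. A derivation with central values on generators kills all brackets, and
the algebra is perfect, so it is zero.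

In `W(2,2)` this applies to both the `L`- and the `H`-coordinates of `p (L m) (L n)`. On the `H n`,
derivations induce maps commuting with the Witt action, hence scalars (`witt_endomorphism_scalar`).
These vanish by `[H, H] = 0` for the `L`-part, and by commutativity for the `H`-part. -/

/-! ### Derivations and commutative products on the Witt algebra -/

/-- A degree `s` derivation of the Witt algebra is inner. -/
theorem witt_derivation_inner (s : ℤ) (a : ℤ → ℂ)
    (h : ∀ m n : ℤ, ((m : ℂ) - n) * a (m + n) = (m + s - n) * a m + (m - n - s) * a n) :
    ∃ α : ℂ, ∀ n : ℤ, a n = α * (s - n) := by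
  by_cases hs : s = 0
  · subst hs
    have h0 : a 0 = 0 := by simpa using h 1 0
    have hadd : ∀ m n : ℤ, m ≠ n → a (m + n) = a m + a n := by
      intro m n hmn
      have hc : ((m : ℂ) - n) ≠ 0 := sub_ne_zero.mpr (by exact_mod_cast hmn)
      apply mul_left_cancel₀ hc
      have := h m n
      push_cast at this
      linear_combination this
    have hneg : a (-1) = -a 1 := by
      have := hadd 1 (-1) (by norm_num)
      norm_num [h0] at this
      linear_combination -this
    -- Additivity holds only at distinct arguments, so doubling is reached through `1 = 2 + (-1)`.
    have h2 : a 2 = 2 * a 1 := by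
      have := hadd 2 (-1) (by norm_num)
      norm_num [hneg] at this
      linear_combination -this
    have hstep : ∀ n : ℤ, a (n + 1) = a n + a 1 := by
      intro n
      by_cases hn : n = 1
      · subst hn
        norm_num
        rw [h2]; ring
      · exact hadd n 1 hn
    refine ⟨-a 1, fun n => ?_⟩
    have : a n = n * a 1 := by
      induction n using Int.induction_on with
      | zero => simp [h0]
      | succ n ih => rw [hstep, ih]; push_cast; ring
      | pred n ih =>
        have := hstep (-(n : ℤ) - 1)
        rw [sub_add_cancel, ih] at this
        push_cast at this ⊢
        linear_combination -this
    rw [this]; push_cast; ring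
  · have hc : (s : ℂ) ≠ 0 := by exact_mod_cast hs
    -- The relation with `L_0` gives `s * a n = (s - n) * a 0`.
    refine ⟨a 0 / s, fun n => ?_⟩
    have := h 0 n
    rw [zero_add] at this
    push_cast at this
    field_simp
    linear_combination this

/-- A degree `s` Witt algebra endomorphism of the adjoint module is zero unless `s = 0`, when it
is a scalar. -/
theorem witt_endomorphism_scalar (u : ℤ → ℤ → ℂ)
    (h : ∀ m n k : ℤ, ((m : ℂ) - n) * u (m + n) k = (2 * m - k) * u n (k - m)) :
    ∃ ν : ℂ, ∀ n k : ℤ, u n k = if k = n then ν else 0 := by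
  refine ⟨u 0 0, fun n k => ?_⟩
  split_ifs with hk
  · subst hk
    by_cases hn : k = 0
    · rw [hn]
    · have hc : (k : ℂ) ≠ 0 := by exact_mod_cast hn
      have := h k 0 k
      rw [add_zero, sub_self] at this
      push_cast at this
      apply mul_left_cancel₀ hc
      linear_combination this
  -- Commuting with `L_0` preserves weights.
  · have hc : (k : ℂ) - n ≠ 0 := sub_ne_zero.mpr (by exact_mod_cast hk)
    have := h 0 n k
    rw [zero_add, sub_zero] at this
    push_cast at this
    apply mul_left_cancel₀ hc
    linear_combination this

/-- A commutative product on the Witt algebra, given by its structure constants `f m n k`, is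
zero if all left multiplications are derivations. -/
theorem witt_commutative_product_eq_zero (f : ℤ → ℤ → ℤ → ℂ)
    (comm : ∀ m n k, f m n k = f n m k)
    (der : ∀ x m n k : ℤ, ((m : ℂ) - n) * f x (m + n) k =
      (k - 2 * n) * f x m (k - n) - (k - 2 * m) * f x n (k - m)) (m n k : ℤ) :
    f m n k = 0 := by
  have inner : ∀ m s : ℤ, ∃ α : ℂ, ∀ n : ℤ, f m n (n + s) = α * (s - n) := by
    intro m s
    apply witt_derivation_inner s fun n => f m n (n + s)
    intro x y
    have := der m x y (x + y + s)
    rw [show x + y + s - y = x + s by ring, show x + y + s - x = y + s by ring] at this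
    push_cast at this
    linear_combination this
  choose α hα using inner
  have hf : ∀ m n k : ℤ, f m n k = α m (k - n) * (k - 2 * n) := by
    intro m n k
    have := hα m (k - n) n
    rw [add_sub_cancel] at this
    rw [this]; push_cast; ring
  have hsymm : ∀ m n s : ℤ, α m s * (s - n) = α n (n + s - m) * (n + s - 2 * m) := by
    intro m n s
    have := comm m n (n + s)
    rw [hf, hf, add_sub_cancel_left] at this
    push_cast at this
    linear_combination this
  have hα0 : ∀ m k : ℤ, α m k * k = α 0 (k - m) * (k - 2 * m) := by
    intro m k
    have := hsymm m 0 k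
    rw [zero_add] at this
    push_cast at this
    linear_combination this
  have hb : ∀ s : ℤ, α 0 s = 0 := by
    intro s
    obtain ⟨m, n, hm, hn, hmn, hsm, hsn⟩ :
        ∃ m n : ℤ, m ≠ 0 ∧ n ≠ 0 ∧ n - m ≠ 0 ∧ s + m ≠ 0 ∧ s + n ≠ 0 := by
      refine ⟨|s| + 1, |s| + 2, ?_, ?_, ?_, ?_, ?_⟩ <;>
        rcases abs_cases s with ⟨h, _⟩ | ⟨h, _⟩ <;> omega
    have h1 := hsymm m n (m + s)
    have h2 := hα0 m (m + s)
    have h3 := hα0 n (n + s)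
    rw [show n + (m + s) - m = n + s by ring] at h1
    rw [add_sub_cancel_left] at h2 h3
    push_cast at h1 h2 h3
    have hcm : (m : ℂ) ≠ 0 := by exact_mod_cast hm
    have hcn : (n : ℂ) ≠ 0 := by exact_mod_cast hn
    have hcmn : (n : ℂ) - m ≠ 0 := by exact_mod_cast hmn
    -- Multiplying `h1` by `(s + n) * (s + m)` lets `h2` and `h3` turn both sides into multiples of
    -- `α 0 s`. The two cubics in `s` differ by the constant `2mn(n - m)`.
    have key : α 0 s * (2 * m * n * ((n : ℂ) - m)) = 0 := by
      linear_combination (s + n : ℂ) * (s + m) * h1 - (s + n : ℂ) * (m + s - n) * h2 +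
        (s + m : ℂ) * (n + s - m) * h3
    simpa [hcm, hcn, hcmn] using key
  have hk : ∀ m k : ℤ, k ≠ 0 → α m k = 0 := by
    intro m k hk
    have := hα0 m k
    rw [hb, zero_mul] at this
    exact (mul_eq_zero.mp this).resolve_right (by exact_mod_cast hk)
  have hall : ∀ m k : ℤ, α m k = 0 := by
    intro m k
    by_cases h : k = 0
    · subst h
      -- Degree zero escapes `hα0`; symmetry with such an `n` moves it to the nonzero degree `n -
      -- m`.
      obtain ⟨n, hn, hnm⟩ : ∃ n : ℤ, n ≠ 0 ∧ n - m ≠ 0 :=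
        ⟨|m| + 1, by positivity, by have := le_abs_self m; omega⟩
      have := hsymm m n 0
      rw [add_zero, hk n _ hnm] at this
      have hcn : (n : ℂ) ≠ 0 := by exact_mod_cast hn
      simpa [hcn] using this
    · exact hk m k h
  rw [hf, hall, zero_mul]

/-- The standard basis vectors are dual to their coordinates. -/
theorem coord_basis_eq_ite {ι V : Type*} [AddCommGroup V] [Module ℂ V]
    (b : Module.Basis ι ℂ V) (i j : ι) [Decidable (i = j)] :
    b.coord i (b j) = if i = j then 1 else 0 := by
  classical
  rw [Module.Basis.coord_apply, Module.Basis.repr_self, Finsupp.single_apply]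
  simp only [eq_comm]

/-! ### The Virasoro algebra -/

namespace Virasoro

theorem coord_L (k n : ℤ) : basis.coord (.L k) (L n) = if k = n then 1 else 0 := by
  classical
  simp [L, coord_basis_eq_ite, -Module.Basis.coord_apply]

theorem coord_c (k : ℤ) : basis.coord (.L k) c = 0 := by
  classical
  simp [c, coord_basis_eq_ite, -Module.Basis.coord_apply]

theorem coord_L_lie (x : Virasoro) (n k : ℤ) :
    basis.coord (.L k) ⁅L n, x⁆ = -((k - 2 * n) * basis.coord (.L (k - n)) x) := by
  have h : (basis.coord (.L k)) ∘ₗ (LieModule.toEnd ℂ Virasoro Virasoro (L n)) =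
      -((k : ℂ) - 2 * n) • basis.coord (.L (k - n)) := by
    refine basis.ext fun i => ?_
    rcases i with m | _
    · change basis.coord (.L k) ⁅L n, L m⁆ = -((k : ℂ) - 2 * n) • basis.coord (.L (k - n)) (L m)
      simp only [lie_L_L, map_add, map_smul, coord_L, coord_c, smul_eq_mul, mul_zero, add_zero]
      by_cases hk : k = n + m
      · rw [if_pos hk, if_pos (by omega), hk]; push_cast; ring
      · rw [if_neg hk, if_neg (by omega)]; simp
    · change basis.coord (.L k) ⁅L n, c⁆ = -((k : ℂ) - 2 * n) • basis.coord (.L (k - n)) c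
      rw [lie_c, map_zero, coord_c, smul_zero]
  have := LinearMap.congr_fun h x
  change basis.coord (.L k) ⁅L n, x⁆ = -((k : ℂ) - 2 * n) * basis.coord (.L (k - n)) x at this
  rw [this]; ring

theorem coord_lie_L (x : Virasoro) (n k : ℤ) :
    basis.coord (.L k) ⁅x, L n⁆ = (k - 2 * n) * basis.coord (.L (k - n)) x := by
  rw [← lie_skew, map_neg, coord_L_lie, neg_neg]

/-- Bracketing with `L 0` kills every coordinate with `k ≠ 0`, and bracketing with `L 1` kills the
one at `k = 0`. -/
theorem coord_eq_zero_of_central {x : Virasoro} (h : ∀ y : Virasoro, ⁅y, x⁆ = 0) (k : ℤ) :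
    basis.coord (.L k) x = 0 := by
  have h0 := coord_L_lie x 0 k
  have h1 := coord_L_lie x 1 (k + 1)
  rw [h, map_zero, eq_comm, neg_eq_zero, mul_eq_zero] at h0 h1
  rw [sub_zero] at h0
  rw [add_sub_cancel_right] at h1
  rcases h0 with h0 | h0
  · refine h1.resolve_left fun h => ?_
    push_cast at h h0
    norm_num at h0
    norm_num [h0] at h
  · exact h0

/-- Derivations preserve the centre; this removes the cocycle term when coordinates of `D ⁅L m, L
n⁆` are compared. -/
theorem derivation_c_central (D : Virasoro →ₗ[ℂ] Virasoro)
    (der : ∀ y z, D ⁅y, z⁆ = ⁅D y, z⁆ + ⁅y, D z⁆) (y : Virasoro) : ⁅y, D c⁆ = 0 := by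
  have h := der y c
  rwa [lie_c, map_zero, lie_c, zero_add, eq_comm] at h

theorem central_of_coord_eq_zero {x : Virasoro} (h : ∀ k, basis.coord (.L k) x = 0)
    (y : Virasoro) : ⁅y, x⁆ = 0 := by
  have : x = basis.coord .c x • c := by
    refine basis.repr.injective (Finsupp.ext fun i => ?_)
    rcases i with k | _
    · simpa [c] using h k
    · simp [c]
  rw [this, lie_smul, lie_c, smul_zero]

/-- A derivation with central values on the `L_m` is zero. -/
theorem derivation_eq_zero (D : Virasoro →ₗ[ℂ] Virasoro)
    (der : ∀ y z, D ⁅y, z⁆ = ⁅D y, z⁆ + ⁅y, D z⁆)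
    (hL : ∀ (m : ℤ) (y : Virasoro), ⁅y, D (L m)⁆ = 0) : D = 0 := by
  have hLL : ∀ m n, D ⁅L m, L n⁆ = 0 := by
    intro m n
    rw [der, hL, ← lie_skew, hL, neg_zero, add_zero]
  -- The cocycle vanishes on `(1, -1)`, which isolates `L 0`; the pair `(2, -2)` then isolates `c`.
  have h0 : D (L 0) = 0 := by
    have := hLL 1 (-1)
    rw [lie_L_L] at this
    norm_num at this
    exact this
  have hc : D c = 0 := by
    have := hLL 2 (-2)
    rw [lie_L_L] at this
    norm_num [h0] at this
    exact this
  refine basis.ext fun i => ?_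
  rcases i with m | _
  · change D (L m) = 0
    by_cases hm : m = 0
    · rw [hm, h0]
    · have := hLL m 0
      rw [lie_L_L, map_add, map_smul, map_smul, hc, smul_zero, add_zero, add_zero] at this
      refine (smul_eq_zero.mp this).resolve_left ?_
      simpa using hm
  · exact hc

theorem commPostLie_eq_zero (p : Virasoro →ₗ[ℂ] Virasoro →ₗ[ℂ] Virasoro)
    (hp : IsCommPostLie p) (x y : Virasoro) : p x y = 0 := by
  have hLL : ∀ m n k, basis.coord (.L k) (p (L m) (L n)) = 0 := by
    refine witt_commutative_product_eq_zero _ (fun m n k => by rw [hp.comm]) fun x m n k => ?_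
    have := congrArg (basis.coord (.L k)) (hp.lie_right (L x) (L m) (L n))
    rw [lie_L_L, map_add (basis.coord _), coord_lie_L, coord_L_lie, map_add, map_smul, map_smul,
      map_add, map_smul, map_smul] at this
    have hc := coord_eq_zero_of_central (derivation_c_central _ (hp.lie_right (L x))) k
    rw [hc, smul_zero, add_zero, smul_eq_mul] at this
    linear_combination this
  have hL : ∀ m, p (L m) = 0 := fun m =>
    derivation_eq_zero _ (hp.lie_right _) fun n => central_of_coord_eq_zero (hLL m n)
  -- Commutativity turns `p (L n) = 0` into vanishing of `p x` on every `L n`.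
  have h : p x = 0 := derivation_eq_zero _ (hp.lie_right x) fun n y => by
    rw [hp.comm, hL, LinearMap.zero_apply, lie_zero]
  rw [h, LinearMap.zero_apply]

end Virasoro

/-! ### Brackets and coordinates in `W(2,2)` -/

namespace W22

theorem lie_H_L (m n : ℤ) :
    ⁅H m, L n⁆ = ((m : ℂ) - n) • H (m + n) +
      (if m + n = 0 then ((m : ℂ) ^ 3 - m) / 12 else 0) • c := by
  have h := virCocycle_skew n m
  unfold virCocycle at h
  rw [← lie_skew, lie_L_H, h, neg_add, add_comm n m, ← neg_smul, ← neg_smul, neg_neg, neg_sub]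

theorem coordL_L (k n : ℤ) : basis.coord (.L k) (L n) = if k = n then 1 else 0 := by
  classical
  simp [L, coord_basis_eq_ite, -Module.Basis.coord_apply]

theorem coordL_H (k n : ℤ) : basis.coord (.L k) (H n) = 0 := by
  classical
  simp [H, coord_basis_eq_ite, -Module.Basis.coord_apply]

theorem coordL_c (k : ℤ) : basis.coord (.L k) c = 0 := by
  classical
  simp [c, coord_basis_eq_ite, -Module.Basis.coord_apply]

theorem coordH_L (k n : ℤ) : basis.coord (.H k) (L n) = 0 := by
  classical
  simp [L, coord_basis_eq_ite, -Module.Basis.coord_apply]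

theorem coordH_H (k n : ℤ) : basis.coord (.H k) (H n) = if k = n then 1 else 0 := by
  classical
  simp [H, coord_basis_eq_ite, -Module.Basis.coord_apply]

theorem coordH_c (k : ℤ) : basis.coord (.H k) c = 0 := by
  classical
  simp [c, coord_basis_eq_ite, -Module.Basis.coord_apply]

theorem coordL_L_lie (x : W22) (n k : ℤ) :
    basis.coord (.L k) ⁅L n, x⁆ = -((k - 2 * n) * basis.coord (.L (k - n)) x) := by
  have h : (basis.coord (.L k)) ∘ₗ (LieModule.toEnd ℂ W22 W22 (L n)) =
      -((k : ℂ) - 2 * n) • basis.coord (.L (k - n)) := by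
    refine basis.ext fun i => ?_
    rcases i with m | m | _
    · change basis.coord (.L k) ⁅L n, L m⁆ =
        -((k : ℂ) - 2 * n) • basis.coord (.L (k - n)) (L m)
      simp only [lie_L_L, map_add, map_smul, coordL_L, coordL_c, smul_eq_mul, mul_zero,
        add_zero]
      by_cases hk : k = n + m
      · rw [if_pos hk, if_pos (by omega), hk]; push_cast; ring
      · rw [if_neg hk, if_neg (by omega)]; simp
    · change basis.coord (.L k) ⁅L n, H m⁆ =
        -((k : ℂ) - 2 * n) • basis.coord (.L (k - n)) (H m)
      simp only [lie_L_H, map_add, map_smul, coordL_H, coordL_c, smul_zero, add_zero]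
    · change basis.coord (.L k) ⁅L n, c⁆ =
        -((k : ℂ) - 2 * n) • basis.coord (.L (k - n)) c
      simp only [lie_c, map_zero, coordL_c, smul_zero]
  have := LinearMap.congr_fun h x
  change basis.coord (.L k) ⁅L n, x⁆ = -((k : ℂ) - 2 * n) * basis.coord (.L (k - n)) x at this
  rw [this]; ring

theorem coordH_L_lie (x : W22) (n k : ℤ) :
    basis.coord (.H k) ⁅L n, x⁆ = -((k - 2 * n) * basis.coord (.H (k - n)) x) := by
  have h : (basis.coord (.H k)) ∘ₗ (LieModule.toEnd ℂ W22 W22 (L n)) =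
      -((k : ℂ) - 2 * n) • basis.coord (.H (k - n)) := by
    refine basis.ext fun i => ?_
    rcases i with m | m | _
    · change basis.coord (.H k) ⁅L n, L m⁆ =
        -((k : ℂ) - 2 * n) • basis.coord (.H (k - n)) (L m)
      simp only [lie_L_L, map_add, map_smul, coordH_L, coordH_c, smul_zero, add_zero]
    · change basis.coord (.H k) ⁅L n, H m⁆ =
        -((k : ℂ) - 2 * n) • basis.coord (.H (k - n)) (H m)
      simp only [lie_L_H, map_add, map_smul, coordH_H, coordH_c, smul_eq_mul, mul_zero,
        add_zero]
      by_cases hk : k = n + m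
      · rw [if_pos hk, if_pos (by omega), hk]; push_cast; ring
      · rw [if_neg hk, if_neg (by omega)]; simp
    · change basis.coord (.H k) ⁅L n, c⁆ =
        -((k : ℂ) - 2 * n) • basis.coord (.H (k - n)) c
      simp only [lie_c, map_zero, coordH_c, smul_zero]
  have := LinearMap.congr_fun h x
  change basis.coord (.H k) ⁅L n, x⁆ = -((k : ℂ) - 2 * n) * basis.coord (.H (k - n)) x at this
  rw [this]; ring

theorem coordL_H_lie (x : W22) (n k : ℤ) :
    basis.coord (.L k) ⁅H n, x⁆ = 0 := by
  have h : (basis.coord (.L k)) ∘ₗ (LieModule.toEnd ℂ W22 W22 (H n)) = 0 := by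
    refine basis.ext fun i => ?_
    rcases i with m | m | _
    · change basis.coord (.L k) ⁅H n, L m⁆ = 0
      simp only [lie_H_L, map_add, map_smul, coordL_H, coordL_c, smul_zero, add_zero]
    · change basis.coord (.L k) ⁅H n, H m⁆ = 0
      simp only [lie_H_H, map_zero]
    · change basis.coord (.L k) ⁅H n, c⁆ = 0
      simp only [lie_c, map_zero]
  exact LinearMap.congr_fun h x

theorem coordH_H_lie (x : W22) (n k : ℤ) :
    basis.coord (.H k) ⁅H n, x⁆ = -((k - 2 * n) * basis.coord (.L (k - n)) x) := by
  have h : (basis.coord (.H k)) ∘ₗ (LieModule.toEnd ℂ W22 W22 (H n)) =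
      -((k : ℂ) - 2 * n) • basis.coord (.L (k - n)) := by
    refine basis.ext fun i => ?_
    rcases i with m | m | _
    · change basis.coord (.H k) ⁅H n, L m⁆ =
        -((k : ℂ) - 2 * n) • basis.coord (.L (k - n)) (L m)
      simp only [lie_H_L, map_add, map_smul, coordL_L, coordH_H, coordH_c, smul_eq_mul, mul_zero,
        add_zero]
      by_cases hk : k = n + m
      · rw [if_pos hk, if_pos (by omega), hk]; push_cast; ring
      · rw [if_neg hk, if_neg (by omega)]; simp
    · change basis.coord (.H k) ⁅H n, H m⁆ =
        -((k : ℂ) - 2 * n) • basis.coord (.L (k - n)) (H m)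
      simp only [lie_H_H, map_zero, coordL_H, smul_zero]
    · change basis.coord (.H k) ⁅H n, c⁆ =
        -((k : ℂ) - 2 * n) • basis.coord (.L (k - n)) c
      simp only [lie_c, map_zero, coordL_c, smul_zero]
  have := LinearMap.congr_fun h x
  change basis.coord (.H k) ⁅H n, x⁆ = -((k : ℂ) - 2 * n) * basis.coord (.L (k - n)) x at this
  rw [this]; ring

theorem coordL_eq_zero_of_central {x : W22} (h : ∀ y : W22, ⁅y, x⁆ = 0) (k : ℤ) :
    basis.coord (.L k) x = 0 := by
  have h0 := coordL_L_lie x 0 k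
  have h1 := coordL_L_lie x 1 (k + 1)
  rw [h, map_zero, eq_comm, neg_eq_zero, mul_eq_zero] at h0 h1
  rw [sub_zero] at h0
  rw [add_sub_cancel_right] at h1
  rcases h0 with h0 | h0
  · refine h1.resolve_left fun h => ?_
    push_cast at h h0
    norm_num at h0
    norm_num [h0] at h
  · exact h0

theorem coordH_eq_zero_of_central {x : W22} (h : ∀ y : W22, ⁅y, x⁆ = 0) (k : ℤ) :
    basis.coord (.H k) x = 0 := by
  have h0 := coordH_L_lie x 0 k
  have h1 := coordH_L_lie x 1 (k + 1)
  rw [h, map_zero, eq_comm, neg_eq_zero, mul_eq_zero] at h0 h1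
  rw [sub_zero] at h0
  rw [add_sub_cancel_right] at h1
  rcases h0 with h0 | h0
  · refine h1.resolve_left fun h => ?_
    push_cast at h h0
    norm_num at h0
    norm_num [h0] at h
  · exact h0

theorem central_of_coord_eq_zero {x : W22} (hL : ∀ k, basis.coord (.L k) x = 0)
    (hH : ∀ k, basis.coord (.H k) x = 0) (y : W22) : ⁅y, x⁆ = 0 := by
  have : x = basis.coord .c x • c := by
    refine basis.repr.injective (Finsupp.ext fun i => ?_)
    rcases i with k | k | _
    · simpa [c] using hL k
    · simpa [c] using hH k
    · simp [c]
  rw [this, lie_smul, lie_c, smul_zero]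

/-! ### Derivations of `W(2,2)` -/

/-- A derivation with central values on the `L_m` and the `H_m` is zero. -/
theorem derivation_eq_zero (D : W22 →ₗ[ℂ] W22)
    (der : ∀ y z, D ⁅y, z⁆ = ⁅D y, z⁆ + ⁅y, D z⁆) (hL : ∀ (m : ℤ) (y : W22), ⁅y, D (L m)⁆ = 0)
    (hH : ∀ (m : ℤ) (y : W22), ⁅y, D (H m)⁆ = 0) : D = 0 := by
  have hLL : ∀ m n, D ⁅L m, L n⁆ = 0 := by
    intro m n
    rw [der, hL, ← lie_skew, hL, neg_zero, add_zero]
  have hLH : ∀ m n, D ⁅L m, H n⁆ = 0 := by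
    intro m n
    rw [der, hH, ← lie_skew, hL, neg_zero, add_zero]
  have h0 : D (L 0) = 0 := by
    have := hLL 1 (-1)
    rw [lie_L_L] at this
    norm_num at this
    exact this
  have hc : D c = 0 := by
    have := hLL 2 (-2)
    rw [lie_L_L] at this
    norm_num [h0] at this
    exact this
  refine basis.ext fun i => ?_
  rcases i with m | m | _
  · change D (L m) = 0
    by_cases hm : m = 0
    · rw [hm, h0]
    · have := hLL m 0
      rw [lie_L_L, map_add, map_smul, map_smul, hc, smul_zero, add_zero, add_zero] at this
      refine (smul_eq_zero.mp this).resolve_left ?_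
      simpa using hm
  · change D (H m) = 0
    by_cases hm : m = 0
    -- Since `[L_0, H_0] = 0`, `H 0` has to come from `[L_1, H_{-1}] = 2 H_0`.
    · have := hLH 1 (-1)
      rw [lie_L_H] at this
      norm_num at this
      rw [hm, this]
    · have := hLH 0 m
      rw [lie_L_H, map_add, map_smul, map_smul, hc, smul_zero, add_zero, zero_add] at this
      refine (smul_eq_zero.mp this).resolve_left ?_
      simpa using hm
  · exact hc

theorem derivation_c_central {D : W22 →ₗ[ℂ] W22}
    (der : ∀ y z, D ⁅y, z⁆ = ⁅D y, z⁆ + ⁅y, D z⁆) (y : W22) : ⁅y, D c⁆ = 0 := by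
  have h := der y c
  rwa [lie_c, map_zero, lie_c, zero_add, eq_comm] at h

theorem coordL_derivation_L {D : W22 →ₗ[ℂ] W22}
    (der : ∀ y z, D ⁅y, z⁆ = ⁅D y, z⁆ + ⁅y, D z⁆) (m n k : ℤ) :
    ((m : ℂ) - n) * basis.coord (.L k) (D (L (m + n))) =
      (k - 2 * n) * basis.coord (.L (k - n)) (D (L m)) -
        (k - 2 * m) * basis.coord (.L (k - m)) (D (L n)) := by
  have h := congrArg (basis.coord (.L k)) (der (L m) (L n))
  rw [← lie_skew (D (L m)) (L n), lie_L_L] at h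
  simp only [map_add, map_neg, map_smul, coordL_L_lie, smul_eq_mul,
    coordL_eq_zero_of_central (derivation_c_central der)] at h
  linear_combination h

theorem coordH_derivation_L {D : W22 →ₗ[ℂ] W22}
    (der : ∀ y z, D ⁅y, z⁆ = ⁅D y, z⁆ + ⁅y, D z⁆) (m n k : ℤ) :
    ((m : ℂ) - n) * basis.coord (.H k) (D (L (m + n))) =
      (k - 2 * n) * basis.coord (.H (k - n)) (D (L m)) -
        (k - 2 * m) * basis.coord (.H (k - m)) (D (L n)) := by
  have h := congrArg (basis.coord (.H k)) (der (L m) (L n))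
  rw [← lie_skew (D (L m)) (L n), lie_L_L] at h
  simp only [map_add, map_neg, map_smul, coordH_L_lie, smul_eq_mul,
    coordH_eq_zero_of_central (derivation_c_central der)] at h
  linear_combination h

/-- Brackets with `H n` have no `L`-part, so `H n ↦ D (H n)` commutes with the Witt action on
`L`-coordinates and is a scalar `μ`. Applying `D` to `[H_1, H_0] = 0` gives `2μ = 0`. -/
theorem coordL_derivation_H {D : W22 →ₗ[ℂ] W22}
    (der : ∀ y z, D ⁅y, z⁆ = ⁅D y, z⁆ + ⁅y, D z⁆) (n k : ℤ) :
    basis.coord (.L k) (D (H n)) = 0 := by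
  obtain ⟨μ, hμ⟩ := witt_endomorphism_scalar (fun n k => basis.coord (.L k) (D (H n))) <| by
    intro m n k
    have h := congrArg (basis.coord (.L k)) (der (L m) (H n))
    rw [← lie_skew (D (L m)) (H n), lie_L_H] at h
    simp only [map_add, map_neg, map_smul, coordL_L_lie, coordL_H_lie, smul_eq_mul,
      coordL_eq_zero_of_central (derivation_c_central der)] at h
    linear_combination h
  have h := congrArg (basis.coord (.H 1)) (der (H 1) (H 0))
  rw [← lie_skew (D (H 1)) (H 0), lie_H_H] at h
  simp only [map_add, map_neg, map_zero, coordH_H_lie, hμ] at h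
  norm_num at h
  have hμ0 : μ = 0 := by linear_combination -h / 2
  rw [hμ, hμ0, ite_self]

/-- A derivation which maps all `L_m` into the span of the `H_m` and `c` acts on the `H_m` by a
scalar, modulo the other basis vectors. -/
theorem coordH_derivation_H {D : W22 →ₗ[ℂ] W22}
    (der : ∀ y z, D ⁅y, z⁆ = ⁅D y, z⁆ + ⁅y, D z⁆)
    (hD : ∀ m k, basis.coord (.L k) (D (L m)) = 0) :
    ∃ ν : ℂ, ∀ n k : ℤ, basis.coord (.H k) (D (H n)) = if k = n then ν else 0 := by
  refine witt_endomorphism_scalar (fun n k => basis.coord (.H k) (D (H n))) fun m n k => ?_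
  have h := congrArg (basis.coord (.H k)) (der (L m) (H n))
  rw [← lie_skew (D (L m)) (H n), lie_L_H] at h
  simp only [map_add, map_neg, map_smul, coordH_L_lie, coordH_H_lie, smul_eq_mul, hD,
    coordH_eq_zero_of_central (derivation_c_central der)] at h
  linear_combination h

/-! ### Commutative post-Lie products on `W(2,2)` -/

theorem commPostLie_eq_zero (p : W22 →ₗ[ℂ] W22 →ₗ[ℂ] W22)
    (hp : IsCommPostLie p) (x y : W22) : p x y = 0 := by
  have hLL_L : ∀ m n k, basis.coord (.L k) (p (L m) (L n)) = 0 :=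
    witt_commutative_product_eq_zero _ (fun m n k => by rw [hp.comm])
      fun x => coordL_derivation_L (hp.lie_right (L x))
  have hLL_H : ∀ m n k, basis.coord (.H k) (p (L m) (L n)) = 0 :=
    witt_commutative_product_eq_zero _ (fun m n k => by rw [hp.comm])
      fun x => coordH_derivation_L (hp.lie_right (L x))
  have hH_L : ∀ x n k, basis.coord (.L k) (p x (H n)) = 0 := fun x =>
    coordL_derivation_H (hp.lie_right x)
  have hHL_L : ∀ m n k, basis.coord (.L k) (p (H m) (L n)) = 0 := fun m n k => by
    rw [hp.comm, hH_L]
  have hHH_H : ∀ m n k, basis.coord (.H k) (p (H m) (H n)) = 0 := by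
    choose ν hν using fun m => coordH_derivation_H (hp.lie_right (H m)) (hHL_L m)
    intro m n k
    -- On `H`-coordinates the product of `H m` and `H (m + 1)` is both `ν m` times the second and `ν
    -- (m + 1)` times the first.
    have hν0 : ν m = 0 := by
      have h := hν m (m + 1) (m + 1)
      rw [hp.comm, hν, if_neg (by omega), if_pos rfl] at h
      exact h.symm
    rw [hν, hν0, ite_self]
  have hLH_H : ∀ m n k, basis.coord (.H k) (p (L m) (H n)) = 0 := by
    choose ν hν using fun m => coordH_derivation_H (hp.lie_right (L m)) (hLL_L m)
    intro m n k
    have inner : ∃ β : ℂ, ∀ j : ℤ, basis.coord (.H (j + (n - m))) (p (H n) (L j)) =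
        β * ((n - m : ℤ) - j) := by
      apply witt_derivation_inner (n - m)
        fun j => basis.coord (.H (j + (n - m))) (p (H n) (L j))
      intro i j
      have := coordH_derivation_L (hp.lie_right (H n)) i j (i + j + (n - m))
      rw [show i + j + (n - m) - j = i + (n - m) by ring,
        show i + j + (n - m) - i = j + (n - m) by ring] at this
      push_cast at this ⊢
      linear_combination this
    obtain ⟨β, hβ⟩ := inner
    -- The same coefficient is affine in `j`, as `p (H n)` is inner on the `L j` in each degree, and
    -- supported at `j = m`, as `p (L j)` is scalar on the `H n`. Hence it vanishes.
    have hj : ∀ j, β * ((n - m : ℤ) - j) = if j = m then ν j else 0 := by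
      intro j
      rw [← hβ, hp.comm, hν]
      congr 1
      exact propext ⟨fun h => by omega, fun h => by omega⟩
    have hβ0 : β = 0 := by
      have h1 := hj (m + 1)
      have h2 := hj (m + 2)
      rw [if_neg (by omega)] at h1 h2
      push_cast at h1 h2
      linear_combination h1 - h2
    have hν0 : ν m = 0 := by
      have h := hj m
      rw [hβ0, zero_mul, if_pos rfl] at h
      exact h.symm
    rw [hν, hν0, ite_self]
  have hL : ∀ m, p (L m) = 0 := fun m => derivation_eq_zero _ (hp.lie_right _)
    (fun n => central_of_coord_eq_zero (hLL_L m n) (hLL_H m n))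
    (fun n => central_of_coord_eq_zero (hH_L _ n) (hLH_H m n))
  -- The vanishing of `p (L n)` supplies the values of `p (H m)` on the `L n`.
  have hH : ∀ m, p (H m) = 0 := fun m => derivation_eq_zero _ (hp.lie_right _)
    (fun n y => by rw [hp.comm, hL, LinearMap.zero_apply, lie_zero])
    (fun n => central_of_coord_eq_zero (hH_L _ n) (hHH_H m n))
  have h : p x = 0 := derivation_eq_zero _ (hp.lie_right x)
    (fun n y => by rw [hp.comm, hL, LinearMap.zero_apply, lie_zero])
    (fun n y => by rw [hp.comm, hH, LinearMap.zero_apply, lie_zero])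
  rw [h, LinearMap.zero_apply]

end W22

theorem mainTheorem5 :
    (∀ p : Virasoro →ₗ[ℂ] Virasoro →ₗ[ℂ] Virasoro, IsCommPostLie p → ∀ x y, p x y = 0) ∧
    (∀ p : W22 →ₗ[ℂ] W22 →ₗ[ℂ] W22, IsCommPostLie p → ∀ x y, p x y = 0) :=
  ⟨Virasoro.commPostLie_eq_zero, W22.commPostLie_eq_zero⟩
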